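/- Let $d\ge 1$, let $\{|0\rangle,\dots,|d-1\rangle\}$ be the standard basis of $\mathbb C^d$, and let $|\phi_+^d\rangle=\frac1{\sqrt d}\sum_{j}|j\rangle\otimes|j\rangle$. For $\alpha\in\mathbb R$ put $$\rho_\alpha^{(d)}=\alpha\,|\phi_+^d\rangle\langle\phi_+^d|+\frac{1-\alpha}{d^2}\,\mathbb 1$$ (for $d\ge 2$ and $-\frac1{d^2-1}\le\alpha\le1$ this is the isotropic two-qudit state). Define the following matrices. * Generalized Gell-Mann matrices (GGB): for $0\le j<k\le d-1$, $\Lambda_s^{jk}=|j\rangle\langle k|+|k\rangle\langle j|$ and $\Lambda_a^{jk}=-i|j\rangle\langle k|+i|k\rangle\langle j|$; for $1\le l\le d-1$, $\Lambda^l=\sqrt{\tfrac{2}{l(l+1)}}\bigl(\sum_{j=0}^{l-1}|j\rangle\langle j|-l\,|l\rangle\langle l|\bigr)$. Put $$\Lambda=\sum_{j<k}\Lambda_s^{jk}\otimes\Lambda_s^{jk}-\sum_{j<k}\Lambda_a^{jk}\otimes\Lambda_a^{jk}+\sum_{l=1}^{d-1}\Lambda^l\otimes\Lambda^l .$$ *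 Polarization operators (POB): with $s=\frac{d-1}2$, $m_k=s-k$, $0\le L\le 2s$, $-L\le M\le L$ ($L$, $M$ integers), $T_{LM}=\sqrt{\tfrac{2L+1}{2s+1}}\sum_{k,l=0}^{d-1}C^{s m_k}_{s m_l,\,LM}\,|k\rangle\langle l|$, where $C^{c\gamma}_{a\alpha,\,b\beta}$ are the Clebsch–Gordan coefficients (Condon–Shortley phases). Put $$T=\sum_{(L,M)\ne(0,0)}T_{LM}\otimes T_{LM}.$$ * Weyl operators (WOB): for $n,m\in\{0,\dots,d-1\}$, $U_{nm}=\sum_{k=0}^{d-1}e^{\frac{2\pi i}{d}kn}\,|k\rangle\langle (k+m)\bmod d|$. Put $$U=\sum_{(l,m)\ne(0,0)}U_{lm}\otimes U_{-l\,m},$$ where $-l$ is taken mod $d$. Then $$|\phi_+^d\rangle\langle\phi_+^d|=\frac1{d^2}\mathbb 1\otimes\mathbb 1+\frac1{2d}\Lambda=\frac1{d^2}\mathbb 1\otimes\mathbb 1+\frac1d T=\frac1{d^2}\mathbb 1\otimes\mathbb 1+\frac1{d^2}U ,$$ for every $\alpha\in\mathbb R$ $$\rho_\alpha^{(d)}=\frac1{d^2}\mathbb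 1\otimes\mathbb 1+\frac{\alpha}{2d}\Lambda=\frac1{d^2}\mathbb 1\otimes\mathbb 1+\frac{\alpha}{d}T=\frac1{d^2}\mathbb 1\otimes\mathbb 1+\frac{\alpha}{d^2}U ,$$ and $\Lambda=2T$, $T=\frac1d U$. -/

import Mathlib

open scoped Kronecker

noncomputable section

namespace Qudit

/-- The standard matrix `|j⟩⟨k|`. The standard basis is indexed from `0`, by `Fin d`. -/
def ketbra (d : ℕ) (j k : Fin d) : Matrix (Fin d) (Fin d) ℂ := Matrix.single j k 1

/-! ### The isotropic two-qudit state -/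

/-- The vector `|φ₊⟩ = (1/√d) ∑ⱼ |j⟩ ⊗ |j⟩` in `ℂᵈ ⊗ ℂᵈ`, in coordinates. -/
def bellVec (d : ℕ) : Fin d × Fin d → ℂ :=
  ((1 / √(d : ℝ) : ℝ) : ℂ) •
    ∑ j : Fin d, fun p => (Pi.single j 1 : Fin d → ℂ) p.1 * (Pi.single j 1 : Fin d → ℂ) p.2

/-- The Bell state `|φ₊⟩⟨φ₊|`. -/
def bellState (d : ℕ) : Matrix (Fin d × Fin d) (Fin d × Fin d) ℂ :=
  Matrix.vecMulVec (bellVec d) (star (bellVec d))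

/-- `ρ_α = α |φ₊⟩⟨φ₊| + ((1 - α)/d²) 1`. -/
def isotropic (d : ℕ) (α : ℝ) : Matrix (Fin d × Fin d) (Fin d × Fin d) ℂ :=
  (α : ℂ) • bellState d + ((1 - (α : ℂ)) / (d : ℂ) ^ 2) • 1

/-! ### Generalized Gell-Mann matrices -/

/-- Symmetric generalized Gell-Mann matrix (used for `j < k`). -/
def ggmSymm (d : ℕ) (j k : Fin d) : Matrix (Fin d) (Fin d) ℂ :=
  ketbra d j k + ketbra d k j

/-- Antisymmetric generalized Gell-Mann matrix (used for `j < k`). -/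
def ggmAnti (d : ℕ) (j k : Fin d) : Matrix (Fin d) (Fin d) ℂ :=
  (-Complex.I) • ketbra d j k + Complex.I • ketbra d k j

/-- Diagonal generalized Gell-Mann matrix `Λˡ`, `1 ≤ l ≤ d - 1`. In the indexing from `0`, the
first `l` basis vectors are those with index `j < l`, and the next one has index `l`. -/
def ggmDiag (d : ℕ) (l : Fin d) : Matrix (Fin d) (Fin d) ℂ :=
  ((√(2 / ((l.val : ℝ) * ((l.val : ℝ) + 1))) : ℝ) : ℂ) •
    ((∑ j : Fin d with j < l, ketbra d j j) - (l.val : ℂ) • ketbra d l l)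

/-- The tensor `Λ`. -/
def bigLambda (d : ℕ) : Matrix (Fin d × Fin d) (Fin d × Fin d) ℂ :=
  (∑ p : Fin d × Fin d with p.1 < p.2, ggmSymm d p.1 p.2 ⊗ₖ ggmSymm d p.1 p.2)
    - (∑ p : Fin d × Fin d with p.1 < p.2, ggmAnti d p.1 p.2 ⊗ₖ ggmAnti d p.1 p.2)
    + ∑ l : Fin d with 1 ≤ l.val, ggmDiag d l ⊗ₖ ggmDiag d l

/-! ### Clebsch-Gordan coefficients and polarization operators -/

/-- `m` is a weight of the spin-`j` representation: `2j` is a natural number and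
`m ∈ {-j, -j+1, …, j}`. -/
def IsWeight (j m : ℚ) : Prop := ∃ p q : ℕ, j + m = p ∧ j - m = q

/-- The triangle condition `|a - b| ≤ c ≤ a + b` with `a + b + c` an integer
(for half-integers `a`, `b`, `c`). -/
def Triangle (a b c : ℚ) : Prop :=
  ∃ p q r : ℕ, a + b - c = p ∧ a - b + c = q ∧ -a + b + c = r

/-- `x!` for a rational number `x` that is a natural number. -/
def qfact (x : ℚ) : ℝ := (Nat.factorial ⌊x⌋₊ : ℝ)

/-- `1 / x!` for an integer `x`, which is `0` for negative `x`. -/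
def invFact (x : ℚ) : ℝ := if x < 0 then 0 else 1 / qfact x

open Classical in
/-- The Clebsch-Gordan coefficient `C^{c γ}_{a α, b β} = ⟨a α; b β | c γ⟩` in the Condon-Shortley
phase convention, by the explicit (van der Waerden, Racah) formula. -/
def clebschGordan (a α b β c γ : ℚ) : ℝ :=
  if IsWeight a α ∧ IsWeight b β ∧ IsWeight c γ ∧ Triangle a b c ∧ γ = α + β then
    √((((2 * c + 1 : ℚ) : ℝ) * qfact (a + b - c) * qfact (a - b + c) * qfact (-a + b + c))
        / qfact (a + b + c + 1))
      * √(qfact (a + α) * qfact (a - α) * qfact (b + β) * qfact (b - β)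
          * qfact (c + γ) * qfact (c - γ))
      * ∑ k ∈ Finset.range (⌊a + b - c⌋₊ + 1),
          (-1 : ℝ) ^ k * invFact k * invFact (a + b - c - k) * invFact (a - α - k)
            * invFact (b + β - k) * invFact (c - b + α + k) * invFact (c - a - β + k)
  else 0

/-- The spin `s = (d - 1)/2`. -/
def spin (d : ℕ) : ℚ := ((d : ℚ) - 1) / 2

/-- The magnetic quantum numbers `s, s - 1, …, -s` attached to the basis vectors in order. -/
def magnetic (d : ℕ) (k : Fin d) : ℚ := spin d - (k.val : ℚ)

/-- The polarization operator `T_{LM}`; note `2s + 1 = d`. -/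
def polOp (d : ℕ) (L : ℕ) (M : ℤ) : Matrix (Fin d) (Fin d) ℂ :=
  ((√((2 * (L : ℝ) + 1) / (2 * (spin d : ℝ) + 1)) : ℝ) : ℂ) •
    ∑ k : Fin d, ∑ l : Fin d,
      ((clebschGordan (spin d) (magnetic d l) (L : ℚ) (M : ℚ) (spin d) (magnetic d k) : ℝ) : ℂ)
        • ketbra d k l

/-- The tensor `T`: the sum over all `0 ≤ L ≤ 2s = d - 1` and `-L ≤ M ≤ L`
with `(L, M) ≠ (0, 0)`. -/
def bigT (d : ℕ) : Matrix (Fin d × Fin d) (Fin d × Fin d) ℂ :=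
  ∑ L ∈ Finset.Icc 1 (d - 1), ∑ M ∈ Finset.Icc (-(L : ℤ)) (L : ℤ), polOp d L M ⊗ₖ polOp d L M

/-! ### Weyl operators -/

/-- The Weyl operator `U_{nm}`. Addition in `Fin d` is addition mod `d`. -/
def weylOp (d : ℕ) (n m : Fin d) : Matrix (Fin d) (Fin d) ℂ :=
  ∑ k : Fin d, Complex.exp (2 * Real.pi * Complex.I / (d : ℂ) * (k.val : ℂ) * (n.val : ℂ))
    • ketbra d k (k + m)

/-- The tensor `U`. The negation `-l` in `Fin d` is taken mod `d`. -/
def bigU (d : ℕ) [NeZero d] : Matrix (Fin d × Fin d) (Fin d × Fin d) ℂ :=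
  ∑ p : Fin d × Fin d with p ≠ (0, 0), weylOp d p.1 p.2 ⊗ₖ weylOp d (-p.1) p.2

end Qudit

end

/-! Write `D` for `deltaTensor d`, which is `d` times the Bell state. For an orthonormal basis `B`
of the matrices with the Hilbert–Schmidt product, completeness says that the sum of `B ⊗ conj B` is
`D`. Each tensor is such a sum, up to scale, with the multiple of the identity left out: conjugation
flips the sign of the antisymmetric Gell-Mann matrices, fixes the real `T_{LM}`, and sends `U_{lm}`
to `U_{-l,m}`. Hence `U = d D - 1`, `T = D - 1/d` and `Λ = 2 D - 2/d` (`bigU_eq`, `bigT_eq`,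
`bigLambda_eq`), and the theorem is a comparison of coefficients of `D` and `1`.

Completeness is checked entrywise. For `U` it is the orthogonality of roots of unity; for `Λ` a
telescoping sum on the diagonal. For `T`, an entry of `T_{LM}` is nonzero only on the diagonal with
column minus row equal to `M`. With `m = |M|` and `L = m + n`, the Racah sum shows that these
entries are, up to sign, orthonormal Hahn functions of degree `n` (`polCoeff_pos`, `polCoeff_neg`).
They form a square matrix with orthonormal rows, so its columns are orthonormal too
(`sum_hahnFun_mul_hahnFun_dual`), which is the completeness needed.

Hahn orthogonality comes from pairing with the rising factorials `shiftedPochhammer m j`: a binomial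
convolution evaluates the sum over points, and what remains is an `n`-th finite difference of a
polynomial of degree `j`. -/

namespace Qudit

/-- The unnormalized projector `∑ⱼₖ |j⟩⟨k| ⊗ |j⟩⟨k|` onto the maximally entangled vector. -/
def deltaTensor (d : ℕ) : Matrix (Fin d × Fin d) (Fin d × Fin d) ℂ :=
  Matrix.of fun p q => if p.1 = p.2 ∧ q.1 = q.2 then 1 else 0

lemma bellVec_apply (d : ℕ) (p : Fin d × Fin d) :
    bellVec d p = ((1 / √(d : ℝ) : ℝ) : ℂ) * if p.1 = p.2 then 1 else 0 := by
  simp only [bellVec, Pi.smul_apply, Finset.sum_apply, smul_eq_mul]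
  congr 1
  simp [Pi.single_apply]

lemma bellState_eq (d : ℕ) : bellState d = (1 / (d : ℂ)) • deltaTensor d := by
  have h : (((1 / √(d : ℝ) : ℝ) : ℂ)) * ((1 / √(d : ℝ) : ℝ) : ℂ) = 1 / (d : ℂ) := by
    rw [← Complex.ofReal_mul, div_mul_div_comm, Real.mul_self_sqrt (Nat.cast_nonneg d)]
    push_cast
    ring
  ext p q
  simp only [bellState, Matrix.vecMulVec_apply, Pi.star_apply, bellVec_apply, Matrix.smul_apply,
    deltaTensor, Matrix.of_apply, smul_eq_mul, ← h, star_mul', Complex.star_def,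
    Complex.conj_ofReal]
  by_cases h1 : p.1 = p.2 <;> by_cases h2 : q.1 = q.2 <;> simp [h1, h2]

/-! ### The Weyl operator expansion -/

lemma weylOp_apply (d : ℕ) (n m i j : Fin d) :
    weylOp d n m i j
      = if j = i + m then
          Complex.exp (2 * Real.pi * Complex.I / (d : ℂ) * (i.val : ℂ) * (n.val : ℂ)) else 0 := by
  simp only [weylOp, ketbra, Matrix.sum_apply, Matrix.smul_apply, Matrix.single_apply, smul_eq_mul]
  rw [Finset.sum_eq_single i]
  · simp [eq_comm]
  · intro b _ hb; simp [hb]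
  · simp

lemma exp_eq_pow (d i n : ℕ) :
    Complex.exp (2 * Real.pi * Complex.I / (d : ℂ) * (i : ℂ) * (n : ℂ))
      = (Complex.exp (2 * Real.pi * Complex.I / (d : ℂ)) ^ i) ^ n := by
  rw [← Complex.exp_nat_mul, ← Complex.exp_nat_mul]
  congr 1
  ring

lemma IsPrimitiveRoot.sum_pow_mul_pow_neg {d : ℕ} [NeZero d] {ζ : ℂ} (hζ : IsPrimitiveRoot ζ d)
    (i j : Fin d) :
    ∑ n : Fin d, (ζ ^ i.val) ^ n.val * (ζ ^ j.val) ^ (-n).val = if i = j then (d : ℂ) else 0 := by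
  have hζ0 : ζ ≠ 0 := hζ.ne_zero (NeZero.ne d)
  have hd : ζ ^ d = 1 := hζ.pow_eq_one
  have key : ∀ n : Fin d, (ζ ^ i.val) ^ n.val * (ζ ^ j.val) ^ (-n).val
      = (ζ ^ i.val / ζ ^ j.val) ^ n.val := by
    intro n
    have h1 : (ζ ^ j.val) ^ (-n).val * (ζ ^ j.val) ^ n.val = 1 := by
      rw [← pow_add, ← pow_mul, mul_comm, pow_mul]
      -- The representative of `-n` is `d - n`, or `0` when `n = 0`; only divisibility of the sum by
      -- `d` is needed.
      have h2 : d ∣ (-n).val + n.val := by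
        apply Nat.dvd_of_mod_eq_zero
        have h3 : ((-n + n : Fin d)).val = 0 := by simp
        rwa [Fin.val_add] at h3
      obtain ⟨c, hc⟩ := h2
      rw [hc, pow_mul, hd, one_pow, one_pow]
    rw [div_pow, eq_div_iff (by positivity), mul_assoc, h1, mul_one]
  simp_rw [key]
  rw [Fin.sum_univ_eq_sum_range fun n => (ζ ^ i.val / ζ ^ j.val) ^ n]
  split_ifs with h
  · subst h
    simp [div_self (pow_ne_zero _ hζ0)]
  · have hne : ζ ^ i.val / ζ ^ j.val ≠ 1 := by
      intro h1
      rw [div_eq_one_iff_eq (pow_ne_zero _ hζ0)] at h1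
      exact h (Fin.ext (hζ.pow_inj i.2 j.2 h1))
    rw [geom_sum_eq hne, div_pow, ← pow_mul, ← pow_mul, mul_comm, pow_mul, hd, mul_comm, pow_mul,
      hd]
    simp

lemma weylOp_zero_zero (d : ℕ) [NeZero d] : weylOp d 0 0 = 1 := by
  ext i j
  simp [weylOp_apply, Matrix.one_apply, eq_comm]

/-- The position of an entry fixes the shift, and the sum over phases then forces the two row
indices to agree. The omitted term is the identity. -/
lemma bigU_eq (d : ℕ) [NeZero d] : bigU d = (d : ℂ) • deltaTensor d - 1 := by
  have hζ : IsPrimitiveRoot (Complex.exp (2 * Real.pi * Complex.I / (d : ℂ))) d :=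
    Complex.isPrimitiveRoot_exp d (NeZero.ne d)
  have hall : ∑ p : Fin d × Fin d, weylOp d p.1 p.2 ⊗ₖ weylOp d (-p.1) p.2
      = (d : ℂ) • deltaTensor d := by
    ext ⟨i, i'⟩ ⟨j, j'⟩
    rw [Fintype.sum_prod_type_right]
    simp only [Matrix.sum_apply, Matrix.kroneckerMap_apply, weylOp_apply, Matrix.smul_apply,
      deltaTensor, Matrix.of_apply, smul_eq_mul, exp_eq_pow]
    rw [Finset.sum_eq_single (j - i)]
    · simp only [add_sub_cancel, if_true]
      by_cases h : j' = i' + (j - i)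
      · simp only [h, if_true]
        rw [IsPrimitiveRoot.sum_pow_mul_pow_neg hζ]
        by_cases h2 : i = i' <;> simp [h2]
      · simp only [h, if_false, mul_zero, Finset.sum_const_zero]
        rw [if_neg, mul_zero]
        rintro ⟨rfl, rfl⟩
        exact h (by simp)
    · intro m _ hm
      have : j ≠ i + m := by rintro rfl; exact hm (by simp)
      simp [this]
    · simp
  rw [← hall, bigU, ← Finset.sum_filter_add_sum_filter_not Finset.univ
    (fun p : Fin d × Fin d => p ≠ (0, 0))]
  have : (Finset.univ.filter fun p : Fin d × Fin d => ¬ p ≠ (0, 0)) = {(0, 0)} := by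
    ext p; simp
  rw [this, Finset.sum_singleton]
  simp [weylOp_zero_zero]

/-! ### The Gell-Mann expansion -/

lemma ketbra_apply (d : ℕ) (j k a b : Fin d) :
    ketbra d j k a b = if j = a ∧ k = b then 1 else 0 := by
  simp [ketbra, Matrix.single_apply]

/-- The mixed products have coefficient `1` in both tensor squares, since `(-i) i = 1`, and cancel;
the pure ones have `1` and `-1`, and double. -/
lemma ggmSymm_kronecker_sub_ggmAnti_kronecker (d : ℕ) (j k : Fin d) :
    ggmSymm d j k ⊗ₖ ggmSymm d j k - ggmAnti d j k ⊗ₖ ggmAnti d j k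
      = (2 : ℂ) • (ketbra d j k ⊗ₖ ketbra d j k + ketbra d k j ⊗ₖ ketbra d k j) := by
  ext p q
  simp only [ggmSymm, ggmAnti, Matrix.sub_apply, Matrix.kroneckerMap_apply, Matrix.add_apply,
    Matrix.smul_apply, smul_eq_mul]
  ring_nf
  rw [Complex.I_sq]
  ring

lemma sum_ggmSymm_sub_sum_ggmAnti (d : ℕ) :
    (∑ p : Fin d × Fin d with p.1 < p.2, ggmSymm d p.1 p.2 ⊗ₖ ggmSymm d p.1 p.2)
      - (∑ p : Fin d × Fin d with p.1 < p.2, ggmAnti d p.1 p.2 ⊗ₖ ggmAnti d p.1 p.2)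
    = (2 : ℂ) • ∑ p : Fin d × Fin d with p.1 ≠ p.2, ketbra d p.1 p.2 ⊗ₖ ketbra d p.1 p.2 := by
  have hunion : (Finset.univ.filter fun p : Fin d × Fin d => p.1 ≠ p.2)
      = (Finset.univ.filter fun p => p.1 < p.2) ∪ (Finset.univ.filter fun p => p.2 < p.1) := by
    ext p
    simp [lt_or_lt_iff_ne]
  have hdisj : Disjoint (Finset.univ.filter fun p : Fin d × Fin d => p.1 < p.2)
      (Finset.univ.filter fun p => p.2 < p.1) := by
    rw [Finset.disjoint_filter]
    exact fun p _ h => lt_asymm h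
  have hswap : ∑ p : Fin d × Fin d with p.2 < p.1, ketbra d p.1 p.2 ⊗ₖ ketbra d p.1 p.2
      = ∑ p : Fin d × Fin d with p.1 < p.2, ketbra d p.2 p.1 ⊗ₖ ketbra d p.2 p.1 := by
    refine Finset.sum_bij' (fun p _ => p.swap) (fun p _ => p.swap) ?_ ?_ ?_ ?_ ?_ <;> simp
  rw [← Finset.sum_sub_distrib, hunion, Finset.sum_union hdisj, hswap, ← Finset.sum_add_distrib,
    Finset.smul_sum]
  exact Finset.sum_congr rfl fun p _ => ggmSymm_kronecker_sub_ggmAnti_kronecker d p.1 p.2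

lemma sum_ketbra_kronecker_apply (d : ℕ) (i i' j j' : Fin d) :
    (∑ p : Fin d × Fin d with p.1 ≠ p.2, ketbra d p.1 p.2 ⊗ₖ ketbra d p.1 p.2) (i, i') (j, j')
      = if i = i' ∧ j = j' ∧ i ≠ j then 1 else 0 := by
  simp only [Matrix.sum_apply, Matrix.kroneckerMap_apply, ketbra_apply]
  rw [Finset.sum_filter, Finset.sum_eq_single (i, j)]
  · by_cases h1 : i = j <;> by_cases h2 : i = i' <;> by_cases h3 : j = j' <;> simp_all
  · rintro ⟨a, b⟩ _ hab
    have : ¬ (a = i ∧ b = j) := by simpa [Prod.ext_iff] using hab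
    simp [this]
  · simp

lemma ggmDiag_apply (d : ℕ) (l i j : Fin d) :
    ggmDiag d l i j = if i = j then
      ((√(2 / ((l.val : ℝ) * ((l.val : ℝ) + 1))) : ℝ) : ℂ)
        * ((if i.val < l.val then 1 else 0) - (l.val : ℂ) * if i.val = l.val then 1 else 0)
      else 0 := by
  simp only [ggmDiag, Matrix.smul_apply, Matrix.sub_apply, Matrix.sum_apply, ketbra_apply,
    smul_eq_mul]
  by_cases h : i = j
  · subst h
    have h1 : ∑ x : Fin d with x < l, (if x = i ∧ x = i then (1 : ℂ) else 0)
        = if i.val < l.val then 1 else 0 := by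
      rw [Finset.sum_filter, Finset.sum_eq_single i]
      · simp
      · intro b _ hb; simp [hb]
      · simp
    rw [h1]
    simp [Fin.ext_iff, eq_comm]
  · have h1 : ∀ x : Fin d, ¬ (x = i ∧ x = j) := fun x hx => h (hx.1.symm.trans hx.2)
    simp [h, h1]

/-- The sum telescopes through `2/(l(l+1)) = 2/l - 2/(l+1)`. Indices `a`, `b` beyond the range are
allowed so that induction on `d` closes. -/
lemma sum_diag_coeff (d a b : ℕ) :
    ∑ l ∈ Finset.range d, (2 / ((l : ℂ) * ((l : ℂ) + 1)))
        * (((if a < l then 1 else 0) - (l : ℂ) * if a = l then 1 else 0)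
          * ((if b < l then 1 else 0) - (l : ℂ) * if b = l then 1 else 0))
      = (if a = b ∧ a < d then 2 else 0) - if a < d ∧ b < d then 2 / (d : ℂ) else 0 := by
  induction d with
  | zero => simp
  | succ d ih =>
    rw [Finset.sum_range_succ, ih]
    have h0 : (d : ℂ) + 1 ≠ 0 := Nat.cast_add_one_ne_zero d
    -- The summand `l = 0` has coefficient `2/0 = 0`, so the first step is treated apart.
    rcases Nat.eq_zero_or_pos d with rfl | hd
    · simp only [Nat.cast_zero, zero_mul, div_zero, zero_add, Nat.cast_one, div_one, not_lt_zero,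
        and_false, if_false, sub_zero]
      split_ifs <;> first | omega | simp
    have h1 : (d : ℂ) ≠ 0 := by exact_mod_cast hd.ne'
    push_cast
    split_ifs <;> first | omega | (field_simp; ring)

lemma sum_ggmDiag_kronecker (d : ℕ) (i i' j j' : Fin d) :
    (∑ l : Fin d with 1 ≤ l.val, ggmDiag d l ⊗ₖ ggmDiag d l) (i, i') (j, j')
      = if i = j ∧ i' = j' then (if i = i' then 2 else 0) - 2 / (d : ℂ) else 0 := by
  -- The matrix with `l = 0` is zero and may be included.
  have hfil : ∑ l : Fin d with 1 ≤ l.val, ggmDiag d l ⊗ₖ ggmDiag d l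
      = ∑ l : Fin d, ggmDiag d l ⊗ₖ ggmDiag d l := by
    refine Finset.sum_filter_of_ne fun l _ hl => ?_
    by_contra h
    apply hl
    have : l.val = 0 := by omega
    ext p q
    simp [ggmDiag_apply, this]
  rw [hfil]
  simp only [Matrix.sum_apply, Matrix.kroneckerMap_apply, ggmDiag_apply]
  by_cases h1 : i = j
  · by_cases h2 : i' = j'
    · simp only [h1, h2, if_true, and_self]
      have := sum_diag_coeff d j.val j'.val
      simp only [j.2, j'.2, and_true, if_true, ← Fin.ext_iff] at this
      rw [← this, ← Fin.sum_univ_eq_sum_range (fun l => (2 / ((l : ℂ) * ((l : ℂ) + 1)))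
        * (((if j.val < l then 1 else 0) - (l : ℂ) * if j.val = l then 1 else 0)
          * ((if j'.val < l then 1 else 0) - (l : ℂ) * if j'.val = l then 1 else 0)))]
      refine Finset.sum_congr rfl fun l _ => ?_
      rw [mul_mul_mul_comm, ← Complex.ofReal_mul, Real.mul_self_sqrt (by positivity)]
      push_cast
      rfl
    · simp [h2]
  · simp [h1]

lemma bigLambda_eq (d : ℕ) :
    bigLambda d = (2 : ℂ) • deltaTensor d - (2 / (d : ℂ)) • 1 := by
  rw [bigLambda, sum_ggmSymm_sub_sum_ggmAnti]
  ext ⟨i, i'⟩ ⟨j, j'⟩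
  rw [Matrix.add_apply, Matrix.smul_apply, sum_ketbra_kronecker_apply, sum_ggmDiag_kronecker]
  simp only [Matrix.sub_apply, Matrix.smul_apply, deltaTensor, Matrix.of_apply, smul_eq_mul,
    Matrix.one_apply, Prod.mk.injEq]
  by_cases h1 : i = i' <;> by_cases h2 : j = j' <;> by_cases h3 : i = j <;>
    by_cases h4 : i' = j' <;> simp_all

end Qudit

/-! ### Binomial sums -/

/-- Counts the `(p + q + 1)`-subsets of `{0, …, n}` by their element `k` that has `p` elements below
it. -/
lemma Nat.sum_range_choose_mul_choose (n p q : ℕ) :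
    ∑ k ∈ Finset.range (n + 1), k.choose p * (n - k).choose q = (n + 1).choose (p + q + 1) := by
  induction n generalizing q with
  | zero =>
    rcases p with _ | p <;> rcases q with _ | q
    · simp
    all_goals
      rw [Nat.choose_eq_zero_of_lt (show 0 + 1 < _ by omega)]
      simp
  | succ n ih =>
    rw [Finset.sum_range_succ]
    have hsub : ∀ k ∈ Finset.range (n + 1), n + 1 - k = (n - k) + 1 := by
      intro k hk
      rw [Finset.mem_range] at hk
      omega
    rcases q with _ | q
    · have := ih 0
      simp only [Nat.choose_zero_right, mul_one] at this ⊢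
      rw [this, add_zero, Nat.choose_succ_succ (n + 1) p, add_comm]
    · rw [Finset.sum_congr rfl fun k hk => by
        rw [hsub k hk, Nat.choose_succ_succ, mul_add], Finset.sum_add_distrib, ih, ih]
      simp only [Nat.sub_self, Nat.choose_zero_succ, mul_zero, add_zero]
      rw [Nat.choose_succ_succ (n + 1) (p + (q + 1))]
      rfl

/-- A shift can be traded for a longer range: the extra end term vanishes because `a ≤ p` and `b ≤
q`. -/
lemma Nat.sum_range_add_choose_mul_add_choose (n a b : ℕ) {p q : ℕ} (hp : a ≤ p) (hq : b ≤ q) :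
    ∑ k ∈ Finset.range (n + 1), (k + a).choose p * (n - k + b).choose q
      = (n + a + b + 1).choose (p + q + 1) := by
  induction a generalizing n with
  | zero =>
    induction b generalizing n with
    | zero => simpa using Nat.sum_range_choose_mul_choose n p q
    | succ b ih =>
      have := ih (by omega) (n + 1)
      rw [Finset.sum_range_succ, Nat.sub_self, zero_add,
        Nat.choose_eq_zero_of_lt (show b < q by omega), mul_zero, add_zero] at this
      rw [show n + 0 + (b + 1) + 1 = n + 1 + 0 + b + 1 by ring, ← this]
      refine Finset.sum_congr rfl fun k hk => ?_
      rw [Finset.mem_range] at hk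
      rw [show n + 1 - k + b = n - k + (b + 1) by omega]
  | succ a ih =>
    have := ih (n + 1) (by omega)
    rw [Finset.sum_range_succ', zero_add, Nat.choose_eq_zero_of_lt (show a < p by omega), zero_mul,
      add_zero] at this
    rw [show n + (a + 1) + b + 1 = n + 1 + a + b + 1 by ring, ← this]
    refine Finset.sum_congr rfl fun k hk => ?_
    rw [show k + 1 + a = k + (a + 1) by ring, Nat.add_sub_add_right]

/-- Turns a weight factor times a falling factorial into a single binomial coefficient, ready for
the convolution above. -/
lemma Nat.factorial_add_mul_descFactorial (k a r : ℕ) :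
    (k + a).factorial * k.descFactorial r
      = k.factorial * ((a + r).factorial * (k + a).choose (a + r)) := by
  rcases lt_or_ge k r with h | h
  · rw [Nat.descFactorial_of_lt h, Nat.choose_eq_zero_of_lt (by omega), mul_zero, mul_zero,
      mul_zero]
  · have h1 := Nat.choose_mul_factorial_mul_factorial (show a + r ≤ k + a by omega)
    rw [show k + a - (a + r) = k - r by omega] at h1
    rw [← h1, ← Nat.factorial_mul_descFactorial h]
    ring

/-! ### Linear functionals on polynomials -/

namespace Polynomial

/-- Subtracting leading terms shows that `φ` kills all degrees below `n`, so only the top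
coefficient matters. -/
lemma map_eq_coeff_mul_of_monic_family (φ : ℝ[X] →ₗ[ℝ] ℝ) (b : ℕ → ℝ[X])
    (hmonic : ∀ j, (b j).Monic) (hdeg : ∀ j, (b j).natDegree = j) {n : ℕ}
    (h0 : ∀ j < n, φ (b j) = 0) {q : ℝ[X]} (hq : q.natDegree ≤ n) :
    φ q = q.coeff n * φ (b n) := by
  have hsub : ∀ (m : ℕ) (q : ℝ[X]), q.degree < (m + 1 : ℕ) →
      (q - C (q.coeff m) * b m).degree < (m : ℕ) := by
    intro m q hq
    rw [Polynomial.degree_lt_iff_coeff_zero] at hq ⊢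
    intro i hi
    rw [coeff_sub, coeff_C_mul]
    rcases hi.eq_or_lt with rfl | hi
    · have : (b m).coeff m = 1 := by simpa [Monic, leadingCoeff, hdeg] using hmonic m
      rw [this, mul_one, sub_self]
    · rw [hq i hi, coeff_eq_zero_of_natDegree_lt (p := b m) (by rwa [hdeg]), mul_zero, sub_zero]
  have hmap : ∀ (m : ℕ) (q : ℝ[X]),
      φ q = φ (q - C (q.coeff m) * b m) + q.coeff m * φ (b m) := by
    intro m q
    rw [← smul_eq_C_mul, map_sub, map_smul, smul_eq_mul]
    ring
  have hlt : ∀ m ≤ n, ∀ q : ℝ[X], q.degree < (m : ℕ) → φ q = 0 := by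
    intro m
    induction m with
    | zero =>
      intro _ q hq
      rw [Polynomial.degree_lt_iff_coeff_zero] at hq
      rw [show q = 0 from Polynomial.ext fun i => by simpa using hq i (Nat.zero_le _), map_zero]
    | succ m ih =>
      intro hm q hq
      rw [hmap m q, ih (by omega) _ (hsub m q hq), h0 m (by omega), mul_zero, zero_add]
  rw [hmap n q, hlt n le_rfl _ (hsub n q ?_), zero_add]
  exact lt_of_le_of_lt (degree_le_of_natDegree_le hq) (by exact_mod_cast Nat.lt_succ_self n)

/-- The sum is `(-1)^n / n!` times the `n`-th forward difference of `q` at `0`. -/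
lemma sum_alternating_eval_of_monic {q : ℝ[X]} (hq : q.Monic) {n : ℕ} (hn : q.natDegree ≤ n) :
    ∑ r ∈ Finset.range (n + 1),
        (-1 : ℝ) ^ r / ((r.factorial : ℝ) * ((n - r).factorial : ℝ)) * q.eval (r : ℝ)
      = if q.natDegree = n then (-1) ^ n else 0 := by
  have hn0 : (n.factorial : ℝ) ≠ 0 := by exact_mod_cast n.factorial_ne_zero
  have key : ∑ r ∈ Finset.range (n + 1),
        (-1 : ℝ) ^ r / ((r.factorial : ℝ) * ((n - r).factorial : ℝ)) * q.eval (r : ℝ)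
      = (-1) ^ n / (n.factorial : ℝ) * (fwdDiff (1 : ℝ))^[n] q.eval 0 := by
    rw [fwdDiff_iter_eq_sum_shift, Finset.mul_sum]
    refine Finset.sum_congr rfl fun r hr => ?_
    have hr : r ≤ n := by
      rw [Finset.mem_range] at hr
      omega
    have hs : (-1 : ℝ) ^ n * (-1) ^ (n - r) = (-1) ^ r := by
      obtain ⟨c, rfl⟩ := Nat.exists_eq_add_of_le hr
      rw [Nat.add_sub_cancel_left, pow_add, mul_assoc, ← mul_pow]
      norm_num
    rw [← hs, zsmul_eq_mul]
    push_cast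
    rw [Nat.cast_choose ℝ hr]
    simp only [zero_add, nsmul_eq_mul, mul_one]
    field_simp
  rw [key]
  split_ifs with h
  · have := congrFun q.fwdDiff_iter_degree_eq_factorial 0
    rw [h] at this
    rw [this, hq.leadingCoeff]
    simp [hn0]
  · rw [fwdDiff_iter_eq_zero_of_degree_lt (lt_of_le_of_ne hn h)]
    simp

end Polynomial

namespace Qudit

open Polynomial Finset

/-- The polynomial `(X + m + 1)(X + m + 2) ⋯ (X + m + j)`. -/
noncomputable def shiftedPochhammer (m j : ℕ) : ℝ[X] :=
  (ascPochhammer ℝ j).comp (X + C ((m : ℝ) + 1))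

lemma monic_shiftedPochhammer (m j : ℕ) : (shiftedPochhammer m j).Monic :=
  (monic_ascPochhammer ℝ j).comp_X_add_C _

lemma natDegree_shiftedPochhammer (m j : ℕ) : (shiftedPochhammer m j).natDegree = j := by
  rw [shiftedPochhammer, natDegree_comp, ascPochhammer_natDegree, natDegree_X_add_C, mul_one]

lemma factorial_mul_eval_shiftedPochhammer (m j k : ℕ) :
    ((k + m).factorial : ℝ) * (shiftedPochhammer m j).eval (k : ℝ)
      = ((k + m + j).factorial : ℝ) := by
  rw [shiftedPochhammer, eval_comp]
  have : (X + C ((m : ℝ) + 1)).eval (k : ℝ) = ((k + m + 1 : ℕ) : ℝ) := by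
    simp
    ring
  rw [this, ascPochhammer_nat_eq_natCast_ascFactorial, ← Nat.cast_mul,
    Nat.factorial_mul_ascFactorial]

/-! ### Hahn polynomials with equal parameters -/

/-- The coefficients of the Hahn polynomial with respect to products of falling factorials
of degree `r` in `x` and of degree `n - r` in `ν - x`. -/
noncomputable def hahnCoeff (m n r : ℕ) : ℝ :=
  (-1) ^ r / ((m + r).factorial * (n - r).factorial * (m + n - r).factorial * r.factorial)

/-- The Hahn polynomial of degree `n` on `{0, …, ν}`, with both parameters equal to `m`. -/
noncomputable def hahnPoly (m ν n : ℕ) : ℝ[X] :=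
  ∑ r ∈ range (n + 1), C (hahnCoeff m n r) *
    (descPochhammer ℝ r * (descPochhammer ℝ (n - r)).comp (C (ν : ℝ) - X))

/-- The weight of the Hahn polynomials. -/
noncomputable def hahnWeight (m ν k : ℕ) : ℝ :=
  ((k + m).factorial / k.factorial) * ((ν - k + m).factorial / (ν - k).factorial)

lemma eval_hahnPoly (m n : ℕ) {ν k : ℕ} (hk : k ≤ ν) :
    (hahnPoly m ν n).eval (k : ℝ)
      = ∑ r ∈ range (n + 1), hahnCoeff m n r *
          ((k.descFactorial r : ℝ) * ((ν - k).descFactorial (n - r) : ℝ)) := by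
  have h : (C (ν : ℝ) - X).eval (k : ℝ) = ((ν - k : ℕ) : ℝ) := by
    simp [Nat.cast_sub hk]
  simp only [hahnPoly, eval_finsetSum, eval_mul, eval_C, eval_comp, h,
    descPochhammer_eval_eq_descFactorial]

lemma natDegree_C_sub_X (a : ℝ) : (C a - X).natDegree = 1 := by
  rw [← neg_sub, natDegree_neg, natDegree_X_sub_C]

lemma leadingCoeff_C_sub_X (a : ℝ) : (C a - X).leadingCoeff = -1 := by
  rw [← neg_sub, leadingCoeff_neg, leadingCoeff_X_sub_C]

lemma natDegree_descPochhammer_comp (a : ℝ) (j : ℕ) :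
    ((descPochhammer ℝ j).comp (C a - X)).natDegree = j := by
  rw [natDegree_comp, descPochhammer_natDegree, natDegree_C_sub_X, mul_one]

lemma natDegree_hahnPoly_le (m ν n : ℕ) : (hahnPoly m ν n).natDegree ≤ n := by
  refine natDegree_sum_le_of_forall_le _ _ fun r hr => ?_
  rw [mem_range] at hr
  refine (natDegree_C_mul_le _ _).trans (natDegree_mul_le.trans ?_)
  rw [natDegree_descPochhammer_comp, descPochhammer_natDegree]
  omega

lemma coeff_hahnPoly (m ν n : ℕ) :
    (hahnPoly m ν n).coeff n
      = (-1) ^ n * ((2 * (m + n)).choose n : ℝ) / ((m + n).factorial : ℝ) ^ 2 := by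
  have hterm : ∀ r ∈ range (n + 1), (C (hahnCoeff m n r) *
      (descPochhammer ℝ r * (descPochhammer ℝ (n - r)).comp (C (ν : ℝ) - X))).coeff n
      = (-1) ^ n / ((m + n).factorial : ℝ) ^ 2 *
        (((m + n).choose r * (m + n).choose (n - r) : ℕ) : ℝ) := by
    intro r hr
    have hr : r ≤ n := by
      rw [mem_range] at hr
      omega
    have h1 : ((descPochhammer ℝ (n - r)).comp (C (ν : ℝ) - X)).coeff (n - r) = (-1) ^ (n - r) := by
      have := coeff_comp_degree_mul_degree (p := descPochhammer ℝ (n - r)) (q := C (ν : ℝ) - X)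
        (by rw [natDegree_C_sub_X]; exact one_ne_zero)
      rwa [natDegree_C_sub_X, mul_one, descPochhammer_natDegree, leadingCoeff_C_sub_X,
        (monic_descPochhammer ℝ _).leadingCoeff, one_mul] at this
    have h2 : (descPochhammer ℝ r).coeff r = 1 := by
      have := monic_descPochhammer ℝ r
      rwa [Monic, leadingCoeff, descPochhammer_natDegree] at this
    have h3 := coeff_mul_add_eq_of_natDegree_le
      (show (descPochhammer ℝ r).natDegree ≤ r from (descPochhammer_natDegree ℝ r).le)
      (natDegree_descPochhammer_comp (ν : ℝ) (n - r)).le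
    rw [Nat.add_sub_cancel' hr, h1, h2, one_mul] at h3
    rw [coeff_C_mul, h3, hahnCoeff, ← Nat.add_sub_cancel' hr, pow_add, Nat.add_sub_cancel' hr]
    push_cast
    rw [Nat.cast_choose ℝ (show r ≤ m + n by omega),
      Nat.cast_choose ℝ (show n - r ≤ m + n by omega), show m + n - (n - r) = m + r by omega]
    field_simp
  -- The signs `(-1)^r` and `(-1)^(n-r)` have merged, so Vandermonde's identity sums the
  -- coefficients.
  rw [hahnPoly, finsetSum_coeff, sum_congr rfl hterm, ← mul_sum, ← Nat.cast_sum,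
    ← Nat.sum_antidiagonal_eq_sum_range_succ (fun i j => (m + n).choose i * (m + n).choose j),
    ← Nat.add_choose_eq, two_mul]
  ring

/-- Summation against the Hahn polynomial of degree `n`, as a functional on polynomials. -/
noncomputable def hahnFunctional (m ν n : ℕ) : ℝ[X] →ₗ[ℝ] ℝ :=
  ∑ k ∈ range (ν + 1), (hahnWeight m ν k * (hahnPoly m ν n).eval (k : ℝ)) • leval (k : ℝ)

lemma hahnFunctional_apply (m ν n : ℕ) (q : ℝ[X]) :
    hahnFunctional m ν n q = ∑ k ∈ range (ν + 1),
      hahnWeight m ν k * (hahnPoly m ν n).eval (k : ℝ) * q.eval (k : ℝ) := by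
  simp [hahnFunctional, LinearMap.sum_apply, leval_apply]

/-- After the sums are exchanged, the sum over `k` is a convolution whose value does not depend on
`r`. -/
lemma hahnFunctional_shiftedPochhammer (m ν : ℕ) {n j : ℕ} (hj : j ≤ n) :
    hahnFunctional m ν n (shiftedPochhammer m j)
      = if j = n then (-1) ^ n * ((ν + 2 * m + n + 1).choose (2 * m + 2 * n + 1) : ℝ) else 0 := by
  have hterm : ∀ k ∈ range (ν + 1), ∀ r ∈ range (n + 1),
      hahnWeight m ν k * (hahnCoeff m n r * ((k.descFactorial r : ℝ) *
        ((ν - k).descFactorial (n - r) : ℝ))) * (shiftedPochhammer m j).eval (k : ℝ)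
      = (hahnCoeff m n r * ((m + j + r).factorial * (m + n - r).factorial)) *
        (((k + (m + j)).choose (m + j + r) * (ν - k + m).choose (m + n - r) : ℕ) : ℝ) := by
    intro k _ r hr
    have hr : r ≤ n := by
      rw [mem_range] at hr
      omega
    have e1 : ((k + (m + j)).factorial : ℝ) * (k.descFactorial r : ℝ)
        = k.factorial * ((m + j + r).factorial * ((k + (m + j)).choose (m + j + r) : ℝ)) := by
      exact_mod_cast Nat.factorial_add_mul_descFactorial k (m + j) r
    have e2 : ((ν - k + m).factorial : ℝ) * ((ν - k).descFactorial (n - r) : ℝ)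
        = (ν - k).factorial * ((m + n - r).factorial *
          ((ν - k + m).choose (m + n - r) : ℝ)) := by
      have := Nat.factorial_add_mul_descFactorial (ν - k) m (n - r)
      rw [← Nat.add_sub_assoc hr] at this
      exact_mod_cast this
    have e3 := factorial_mul_eval_shiftedPochhammer m j k
    rw [add_assoc] at e3
    have hk0 : (k.factorial : ℝ) ≠ 0 := by exact_mod_cast k.factorial_ne_zero
    have hk1 : ((ν - k).factorial : ℝ) ≠ 0 := by exact_mod_cast (ν - k).factorial_ne_zero
    calc _ = hahnCoeff m n r * ((((k + m).factorial : ℝ) * (shiftedPochhammer m j).eval (k : ℝ))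
          * (k.descFactorial r : ℝ) / k.factorial)
          * (((ν - k + m).factorial : ℝ) * ((ν - k).descFactorial (n - r) : ℝ)
            / (ν - k).factorial) := by
          rw [hahnWeight]
          ring
      _ = _ := by
          rw [e3, e1, e2, mul_div_cancel_left₀ _ hk0, mul_div_cancel_left₀ _ hk1]
          push_cast
          ring
  have hswap : hahnFunctional m ν n (shiftedPochhammer m j)
      = ∑ r ∈ range (n + 1), (hahnCoeff m n r * ((m + j + r).factorial * (m + n - r).factorial)) *
          ((ν + 2 * m + j + 1).choose (2 * m + n + j + 1) : ℝ) := by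
    rw [hahnFunctional_apply]
    rw [sum_congr rfl fun k hk => by
      rw [eval_hahnPoly m n (show k ≤ ν by rw [mem_range] at hk; omega), mul_sum, sum_mul,
        sum_congr rfl (hterm k hk)], sum_comm]
    refine sum_congr rfl fun r hr => ?_
    rw [mem_range] at hr
    rw [← mul_sum, ← Nat.cast_sum, Nat.sum_range_add_choose_mul_add_choose ν (m + j) m
      (by omega) (by omega)]
    congr 3 <;> omega
  -- The quotient `(m+j+r)!/(m+r)!` is the test polynomial again, now at `r`; this exposes the
  -- finite difference.
  have hcoeff : ∀ r ∈ range (n + 1),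
      hahnCoeff m n r * ((m + j + r).factorial * (m + n - r).factorial)
      = (-1) ^ r / ((r.factorial : ℝ) * ((n - r).factorial : ℝ)) *
        (shiftedPochhammer m j).eval (r : ℝ) := by
    intro r _
    have h := factorial_mul_eval_shiftedPochhammer m j r
    rw [show m + j + r = r + m + j by ring, ← h, hahnCoeff, add_comm m r]
    field_simp
  rw [hswap, ← sum_mul, sum_congr rfl hcoeff,
    sum_alternating_eval_of_monic (monic_shiftedPochhammer m j)
      ((natDegree_shiftedPochhammer m j).trans_le hj), natDegree_shiftedPochhammer]
  split_ifs with h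
  · subst h
    rw [show 2 * m + j + j + 1 = 2 * m + 2 * j + 1 by ring]
  · rw [zero_mul]

/-- The reciprocal of the squared norm of `hahnPoly m ν n`. -/
noncomputable def hahnNorm (m ν n : ℕ) : ℝ :=
  (2 * ((m + n : ℕ) : ℝ) + 1) * (m + n).factorial ^ 2 * (ν - n).factorial
    * (2 * m + n).factorial * n.factorial / (ν + 2 * m + n + 1).factorial

lemma hahnNorm_pos (m ν n : ℕ) : 0 < hahnNorm m ν n := by
  unfold hahnNorm
  positivity

lemma hahnFunctional_hahnPoly_self (m : ℕ) {ν n : ℕ} (hn : n ≤ ν) :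
    hahnFunctional m ν n (hahnPoly m ν n) = (hahnNorm m ν n)⁻¹ := by
  rw [map_eq_coeff_mul_of_monic_family (hahnFunctional m ν n) (shiftedPochhammer m)
    (monic_shiftedPochhammer m) (natDegree_shiftedPochhammer m)
    (fun j hj => by rw [hahnFunctional_shiftedPochhammer m ν hj.le, if_neg hj.ne])
    (natDegree_hahnPoly_le m ν n), hahnFunctional_shiftedPochhammer m ν le_rfl, if_pos rfl,
    coeff_hahnPoly, Nat.cast_choose ℝ (show n ≤ 2 * (m + n) by omega),
    Nat.cast_choose ℝ (show 2 * m + 2 * n + 1 ≤ ν + 2 * m + n + 1 by omega),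
    show 2 * (m + n) - n = 2 * m + n by omega,
    show ν + 2 * m + n + 1 - (2 * m + 2 * n + 1) = ν - n by omega, hahnNorm,
    show 2 * (m + n) = 2 * m + 2 * n by ring, Nat.factorial_succ (2 * m + 2 * n)]
  have hs : ((-1 : ℝ) ^ n) * (-1) ^ n = 1 := by
    rw [← mul_pow]
    norm_num
  push_cast
  rw [inv_div]
  have h1 : (2 * (m : ℝ) + 2 * n + 1) ≠ 0 := by positivity
  have h2 : (2 * ((m : ℝ) + n) + 1) ≠ 0 := by positivity
  field_simp
  rw [pow_two, hs]

lemma hahnFunctional_hahnPoly_of_lt (m ν : ℕ) {n n' : ℕ} (hn : n' < n) :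
    hahnFunctional m ν n (hahnPoly m ν n') = 0 := by
  have hd := (natDegree_hahnPoly_le m ν n').trans_lt hn
  rw [map_eq_coeff_mul_of_monic_family (hahnFunctional m ν n) (shiftedPochhammer m)
    (monic_shiftedPochhammer m) (natDegree_shiftedPochhammer m)
    (fun j hj => by rw [hahnFunctional_shiftedPochhammer m ν hj.le, if_neg hj.ne])
    hd.le, coeff_eq_zero_of_natDegree_lt hd, zero_mul]

/-- The orthonormal Hahn functions. -/
noncomputable def hahnFun (m ν n k : ℕ) : ℝ :=
  √(hahnNorm m ν n) * √(hahnWeight m ν k) * (hahnPoly m ν n).eval (k : ℝ)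

lemma hahnWeight_nonneg (m ν k : ℕ) : 0 ≤ hahnWeight m ν k := by
  unfold hahnWeight
  positivity

lemma sum_hahnFun_mul_hahnFun (m : ℕ) {ν n n' : ℕ} (hn : n ≤ ν) :
    ∑ k ∈ range (ν + 1), hahnFun m ν n k * hahnFun m ν n' k = if n = n' then 1 else 0 := by
  have h : ∑ k ∈ range (ν + 1), hahnFun m ν n k * hahnFun m ν n' k
      = √(hahnNorm m ν n) * √(hahnNorm m ν n') * ∑ k ∈ range (ν + 1),
        hahnWeight m ν k * (hahnPoly m ν n).eval (k : ℝ) * (hahnPoly m ν n').eval (k : ℝ) := by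
    rw [mul_sum]
    refine sum_congr rfl fun k _ => ?_
    rw [← Real.mul_self_sqrt (hahnWeight_nonneg m ν k), hahnFun, hahnFun]
    ring_nf
  rw [h]
  -- The functional must belong to the larger degree, so the factors are exchanged when `n < n'`.
  rcases lt_trichotomy n n' with hlt | rfl | hlt
  · rw [if_neg hlt.ne, sum_congr rfl fun k _ => mul_right_comm _ _ _, ← hahnFunctional_apply,
      hahnFunctional_hahnPoly_of_lt m ν hlt, mul_zero]
  · rw [if_pos rfl, ← hahnFunctional_apply, hahnFunctional_hahnPoly_self m hn,
      Real.mul_self_sqrt (hahnNorm_pos m ν n).le, mul_inv_cancel₀ (hahnNorm_pos m ν n).ne']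
  · rw [if_neg hlt.ne', ← hahnFunctional_apply, hahnFunctional_hahnPoly_of_lt m ν hlt, mul_zero]

lemma sum_hahnFun_mul_hahnFun_dual (m : ℕ) {ν k k' : ℕ} (hk : k ≤ ν) (hk' : k' ≤ ν) :
    ∑ n ∈ range (ν + 1), hahnFun m ν n k * hahnFun m ν n k' = if k = k' then 1 else 0 := by
  let A : Matrix (Fin (ν + 1)) (Fin (ν + 1)) ℝ := Matrix.of fun n k => hahnFun m ν n k
  have hA : A * A.transpose = 1 := by
    ext n n'
    rw [Matrix.mul_apply, Matrix.one_apply]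
    simp only [A, Matrix.transpose_apply, Matrix.of_apply]
    rw [Fin.sum_univ_eq_sum_range fun k => hahnFun m ν n k * hahnFun m ν n' k,
      sum_hahnFun_mul_hahnFun m (Nat.lt_succ_iff.mp n.2)]
    simp [Fin.ext_iff]
  have hA'' : A.transpose * A = 1 := mul_eq_one_comm.mp hA
  have hA' := congrFun (congrFun hA'' ⟨k, Nat.lt_succ_of_le hk⟩)
    ⟨k', Nat.lt_succ_of_le hk'⟩
  rw [Matrix.mul_apply, Matrix.one_apply] at hA'
  simp only [A, Matrix.transpose_apply, Matrix.of_apply] at hA'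
  rw [Fin.sum_univ_eq_sum_range fun n => hahnFun m ν n k * hahnFun m ν n k'] at hA'
  simpa [Fin.ext_iff] using hA'

end Qudit

namespace Qudit

open Finset

/-! ### Evaluation of the Clebsch-Gordan coefficients -/

lemma qfact_eq {x : ℚ} {n : ℕ} (h : x = n) : qfact x = (n.factorial : ℝ) := by
  rw [qfact, h, Nat.floor_natCast]

lemma invFact_of_neg {x : ℚ} (h : x < 0) : invFact x = 0 := if_pos h

lemma invFact_natCast (n : ℕ) : invFact (n : ℚ) = 1 / (n.factorial : ℝ) := by
  rw [invFact, if_neg (not_lt.mpr (Nat.cast_nonneg n)), qfact_eq rfl]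

/-- The falling factorial vanishes exactly where the convention `1/x! = 0` for negative `x` applies,
so no case split survives. -/
lemma invFact_sub (a b : ℕ) :
    invFact ((a : ℚ) - b) = (a.descFactorial b : ℝ) / (a.factorial : ℝ) := by
  rcases lt_or_ge a b with h | h
  · have h' : (a : ℚ) < b := by exact_mod_cast h
    rw [invFact_of_neg (by linarith), Nat.descFactorial_of_lt h, Nat.cast_zero, zero_div]
  · rw [← Nat.cast_sub h, invFact_natCast, ← Nat.factorial_mul_descFactorial h, Nat.cast_mul,
      div_mul_cancel_right₀, one_div]
    exact_mod_cast (Nat.descFactorial_eq_zero_iff_lt.not.mpr (not_lt.mpr h))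

/-- Here `u = L + M` and `v = L - M`, so the factorials outside the sum have natural arguments;
`hlk` is the selection rule `M = l - k`. -/
lemma clebschGordan_spin {N L k l u v : ℕ} (hL : L ≤ N) (hk : k ≤ N) (hl : l ≤ N)
    (huv : u + v = 2 * L) (hlk : l + L = k + u) :
    clebschGordan ((N : ℚ) / 2) ((N : ℚ) / 2 - l) L ((u : ℚ) - L) ((N : ℚ) / 2) ((N : ℚ) / 2 - k)
      = √((((N : ℝ) + 1) * L.factorial * (N - L).factorial * L.factorial)
          / (N + L + 1).factorial)
        * √(((N - l).factorial : ℝ) * l.factorial * u.factorial * v.factorial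
            * (N - k).factorial * k.factorial)
        * ∑ t ∈ range (L + 1), (-1 : ℝ) ^ t * invFact t * invFact ((L : ℚ) - t)
            * invFact ((l : ℚ) - t) * invFact ((u : ℚ) - t) * invFact ((N : ℚ) - L - l + t)
            * invFact ((t : ℚ) + L - u) := by
  have hv : (v : ℚ) = 2 * L - u := by
    have : (u : ℚ) + v = 2 * L := by exact_mod_cast huv
    linarith
  have hlk' : (l : ℚ) + L = k + u := by exact_mod_cast hlk
  have hNL : ((N - L : ℕ) : ℚ) = N - L := Nat.cast_sub hL
  have hNk : ((N - k : ℕ) : ℚ) = N - k := Nat.cast_sub hk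
  have hNl : ((N - l : ℕ) : ℚ) = N - l := Nat.cast_sub hl
  have hcond : IsWeight ((N : ℚ) / 2) ((N : ℚ) / 2 - l) ∧ IsWeight (L : ℚ) ((u : ℚ) - L) ∧
      IsWeight ((N : ℚ) / 2) ((N : ℚ) / 2 - k) ∧ Triangle ((N : ℚ) / 2) L ((N : ℚ) / 2) ∧
      (N : ℚ) / 2 - k = (N : ℚ) / 2 - l + ((u : ℚ) - L) := by
    refine ⟨⟨N - l, l, ?_, ?_⟩, ⟨u, v, ?_, ?_⟩, ⟨N - k, k, ?_, ?_⟩, ⟨L, N - L, L, ?_, ?_, ?_⟩, ?_⟩ <;>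
      linarith
  have hfl : ⌊(N : ℚ) / 2 + L - (N : ℚ) / 2⌋₊ = L := by
    rw [add_sub_cancel_left, Nat.floor_natCast]
  rw [clebschGordan, if_pos hcond, hfl,
    qfact_eq (show (N : ℚ) / 2 + L - (N : ℚ) / 2 = (L : ℕ) by ring),
    qfact_eq (show (N : ℚ) / 2 - L + (N : ℚ) / 2 = (N - L : ℕ) by linarith),
    qfact_eq (show -((N : ℚ) / 2) + L + (N : ℚ) / 2 = (L : ℕ) by ring),
    qfact_eq (show (N : ℚ) / 2 + L + (N : ℚ) / 2 + 1 = (N + L + 1 : ℕ) by push_cast; ring),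
    qfact_eq (show (N : ℚ) / 2 + ((N : ℚ) / 2 - l) = (N - l : ℕ) by linarith),
    qfact_eq (show (N : ℚ) / 2 - ((N : ℚ) / 2 - l) = (l : ℕ) by ring),
    qfact_eq (show (L : ℚ) + ((u : ℚ) - L) = (u : ℕ) by ring),
    qfact_eq (show (L : ℚ) - ((u : ℚ) - L) = (v : ℕ) by linarith),
    qfact_eq (show (N : ℚ) / 2 + ((N : ℚ) / 2 - k) = (N - k : ℕ) by linarith),
    qfact_eq (show (N : ℚ) / 2 - ((N : ℚ) / 2 - k) = (k : ℕ) by ring)]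
  congr 1
  · congr 3
    push_cast
    ring
  · refine sum_congr rfl fun t _ => ?_
    congr 3
    · congr 3 <;> ring
    · ring_nf
    · ring
    · ring

/-- Case `M = m`: the last factor is `1/(t - m)!`, so the sum starts at `t = m`; putting `t = m + r`
produces the sign. -/
lemma sum_invFact_pos {m ν n k : ℕ} (hk : k ≤ ν) :
    ∑ t ∈ range (m + n + 1), (-1 : ℝ) ^ t * invFact t * invFact (((m + n : ℕ) : ℚ) - t)
        * invFact (((k + m : ℕ) : ℚ) - t) * invFact (((2 * m + n : ℕ) : ℚ) - t)
        * invFact (((ν + m : ℕ) : ℚ) - (m + n : ℕ) - (k + m : ℕ) + t)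
        * invFact ((t : ℚ) + (m + n : ℕ) - (2 * m + n : ℕ))
      = (-1) ^ m * (hahnPoly m ν n).eval (k : ℝ) / (k.factorial * (ν - k).factorial) := by
  rw [add_assoc, sum_range_add, sum_eq_zero, zero_add, eval_hahnPoly m n hk, mul_sum, sum_div]
  · refine sum_congr rfl fun r hr => ?_
    have hr : r ≤ n := by
      rw [mem_range] at hr
      omega
    have hνk : ((ν - k : ℕ) : ℚ) = ν - k := Nat.cast_sub hk
    have hnr : ((n - r : ℕ) : ℚ) = n - r := Nat.cast_sub hr
    have hmnr : ((m + n - r : ℕ) : ℚ) = m + n - r := by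
      rw [Nat.cast_sub (by omega)]
      push_cast
      ring
    rw [show ((m + n : ℕ) : ℚ) - (m + r : ℕ) = (n - r : ℕ) by push_cast [hnr]; ring,
      show ((k + m : ℕ) : ℚ) - (m + r : ℕ) = (k : ℚ) - r by push_cast; ring,
      show ((2 * m + n : ℕ) : ℚ) - (m + r : ℕ) = (m + n - r : ℕ) by rw [hmnr]; push_cast; ring,
      show ((ν + m : ℕ) : ℚ) - (m + n : ℕ) - (k + m : ℕ) + (m + r : ℕ)
        = ((ν - k : ℕ) : ℚ) - (n - r : ℕ) by rw [hνk, hnr]; push_cast; ring,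
      show ((m + r : ℕ) : ℚ) + (m + n : ℕ) - (2 * m + n : ℕ) = (r : ℕ) by push_cast; ring]
    rw [invFact_sub, invFact_sub]
    simp only [invFact_natCast]
    rw [hahnCoeff, pow_add]
    field_simp
  · intro t ht
    rw [mem_range] at ht
    have ht' : (t : ℚ) < m := by exact_mod_cast ht
    rw [invFact_of_neg (x := (t : ℚ) + (m + n : ℕ) - (2 * m + n : ℕ)) (by push_cast; linarith),
      mul_zero]

/-- Case `M = -m`: the factor `1/(n - t)!` stops the sum at `t = n`, with no change of index and
hence no sign. -/
lemma sum_invFact_neg {m ν n k : ℕ} (hk : k ≤ ν) :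
    ∑ t ∈ range (m + n + 1), (-1 : ℝ) ^ t * invFact t * invFact (((m + n : ℕ) : ℚ) - t)
        * invFact ((k : ℚ) - t) * invFact ((n : ℚ) - t)
        * invFact (((ν + m : ℕ) : ℚ) - (m + n : ℕ) - k + t)
        * invFact ((t : ℚ) + (m + n : ℕ) - n)
      = (hahnPoly m ν n).eval (k : ℝ) / (k.factorial * (ν - k).factorial) := by
  rw [show m + n + 1 = n + 1 + m by ring, sum_range_add, add_comm,
    sum_eq_zero (s := range m), zero_add, eval_hahnPoly m n hk, sum_div]
  · refine sum_congr rfl fun r hr => ?_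
    have hr : r ≤ n := by
      rw [mem_range] at hr
      omega
    have hνk : ((ν - k : ℕ) : ℚ) = ν - k := Nat.cast_sub hk
    have hnr : ((n - r : ℕ) : ℚ) = n - r := Nat.cast_sub hr
    have hmnr : ((m + n : ℕ) : ℚ) - r = (m + n - r : ℕ) := by
      rw [Nat.cast_sub (by omega)]
    rw [hmnr, ← hnr,
      show ((ν + m : ℕ) : ℚ) - (m + n : ℕ) - k + r
        = ((ν - k : ℕ) : ℚ) - (n - r : ℕ) by rw [hνk, hnr]; push_cast; ring,
      show (r : ℚ) + (m + n : ℕ) - n = (m + r : ℕ) by push_cast; ring]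
    rw [invFact_sub, invFact_sub]
    simp only [invFact_natCast]
    rw [hahnCoeff]
    field_simp
  · intro t _
    have ht : (0 : ℚ) ≤ t := Nat.cast_nonneg t
    rw [invFact_of_neg (x := (n : ℚ) - (n + 1 + t : ℕ)) (by push_cast; linarith), mul_zero, zero_mul,
      zero_mul]

lemma sqrt_prefactor_eq (m ν n k : ℕ) :
    √((2 * ((m + n : ℕ) : ℝ) + 1) / ((ν + m : ℕ) + 1))
      * (√(((((ν + m : ℕ) : ℝ) + 1) * (m + n).factorial * (ν + m - (m + n)).factorial
            * (m + n).factorial) / (ν + m + (m + n) + 1).factorial)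
        * √(((ν - k).factorial : ℝ) * (k + m).factorial * (2 * m + n).factorial * n.factorial
            * (ν - k + m).factorial * k.factorial))
      = √(hahnNorm m ν n) * √(hahnWeight m ν k) * (k.factorial * (ν - k).factorial) := by
  have h : (0 : ℝ) ≤ k.factorial * (ν - k).factorial := by positivity
  rw [← Real.sqrt_mul (by positivity), ← Real.sqrt_mul (by positivity),
    ← Real.sqrt_mul (hahnNorm_pos m ν n).le]
  -- Both sides become single square roots, and the radicands can be compared.
  conv_rhs => rw [← Real.sqrt_sq h]
  rw [← Real.sqrt_mul (mul_nonneg (hahnNorm_pos m ν n).le (hahnWeight_nonneg m ν k)),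
    hahnNorm, hahnWeight, show ν + m - (m + n) = ν - n by omega,
    show ν + m + (m + n) + 1 = ν + 2 * m + n + 1 by ring]
  congr 1
  have h1 : (((ν + m : ℕ) : ℝ) + 1) ≠ 0 := by positivity
  field_simp

/-! ### The polarization operator expansion -/

/-- The entries of the polarization operators, which are real. -/
noncomputable def polCoeff (N L : ℕ) (M : ℤ) (k l : ℕ) : ℝ :=
  √((2 * (L : ℝ) + 1) / ((N : ℝ) + 1)) *
    clebschGordan ((N : ℚ) / 2) ((N : ℚ) / 2 - l) L M ((N : ℚ) / 2) ((N : ℚ) / 2 - k)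

lemma polOp_apply (N L : ℕ) (M : ℤ) (k l : Fin (N + 1)) :
    polOp (N + 1) L M k l = (polCoeff N L M k l : ℂ) := by
  have hs : spin (N + 1) = (N : ℚ) / 2 := by
    rw [spin]
    push_cast
    ring
  have hd : 2 * ((((N : ℚ) / 2 : ℚ)) : ℝ) + 1 = (N : ℝ) + 1 := by
    push_cast
    ring
  simp only [polOp, magnetic, hs, hd, polCoeff, Matrix.smul_apply, Matrix.sum_apply, ketbra_apply,
    smul_eq_mul, Complex.ofReal_mul]
  congr 1
  rw [sum_eq_single k, sum_eq_single l]
  · simp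
  · intro b _ hb
    simp [hb]
  · simp
  · intro b _ hb
    simp [hb]
  · simp

lemma polCoeff_eq_zero {N L : ℕ} {M : ℤ} {k l : ℕ} (h : M ≠ (l : ℤ) - k) :
    polCoeff N L M k l = 0 := by
  rw [polCoeff, clebschGordan, if_neg, mul_zero]
  rintro ⟨-, -, -, -, h'⟩
  apply h
  have : (M : ℚ) = ((l : ℤ) - k : ℤ) := by
    push_cast
    linarith
  exact_mod_cast this

lemma polCoeff_pos {m ν n k : ℕ} (hn : n ≤ ν) (hk : k ≤ ν) :
    polCoeff (ν + m) (m + n) m k (k + m) = (-1) ^ m * hahnFun m ν n k := by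
  have h := clebschGordan_spin (N := ν + m) (L := m + n) (k := k) (l := k + m) (u := 2 * m + n)
    (v := n) (by omega) (by omega) (by omega) (by omega) (by omega)
  rw [show ((2 * m + n : ℕ) : ℚ) - (m + n : ℕ) = ((m : ℤ) : ℚ) by push_cast; ring,
    sum_invFact_pos hk, show ν + m - (k + m) = ν - k by omega,
    show ν + m - k = ν - k + m by omega] at h
  have hk0 : (k.factorial * (ν - k).factorial : ℝ) ≠ 0 := by positivity
  rw [polCoeff, h, ← mul_assoc, sqrt_prefactor_eq m ν n k, hahnFun]
  field_simp

lemma polCoeff_neg {m ν n k : ℕ} (hn : n ≤ ν) (hk : k ≤ ν) :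
    polCoeff (ν + m) (m + n) (-m) (k + m) k = hahnFun m ν n k := by
  have h := clebschGordan_spin (N := ν + m) (L := m + n) (k := k + m) (l := k) (u := n)
    (v := 2 * m + n) (by omega) (by omega) (by omega) (by omega) (by omega)
  rw [show (n : ℚ) - (m + n : ℕ) = ((-m : ℤ) : ℚ) by push_cast; ring,
    sum_invFact_neg hk, show ν + m - (k + m) = ν - k by omega,
    show ν + m - k = ν - k + m by omega,
    show ((ν - k + m).factorial : ℝ) * k.factorial * n.factorial * (2 * m + n).factorial
      * (ν - k).factorial * (k + m).factorial = ((ν - k).factorial : ℝ) * (k + m).factorial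
      * (2 * m + n).factorial * n.factorial * (ν - k + m).factorial * k.factorial by ring] at h
  have hk0 : (k.factorial * (ν - k).factorial : ℝ) ≠ 0 := by positivity
  rw [polCoeff, h, ← mul_assoc, sqrt_prefactor_eq m ν n k, hahnFun]
  field_simp

/-- The value `M₀` is admissible exactly when `m ≤ L`, so `L = m + n` with `n ≤ ν`. -/
lemma sum_range_sum_Icc_eq {m ν : ℕ} {f : ℕ → ℤ → ℝ} {M₀ : ℤ} (hM₀ : M₀.natAbs = m)
    (hf : ∀ L M, M ≠ M₀ → f L M = 0) :
    ∑ L ∈ range (ν + m + 1), ∑ M ∈ Icc (-(L : ℤ)) L, f L M = ∑ n ∈ range (ν + 1), f (m + n) M₀ := by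
  have hin : ∀ L : ℕ, ∑ M ∈ Icc (-(L : ℤ)) L, f L M = if m ≤ L then f L M₀ else 0 := by
    intro L
    split_ifs with h
    · exact sum_eq_single_of_mem M₀ (by rw [mem_Icc]; omega) fun M _ hM => hf L M hM
    · refine sum_eq_zero fun M hM => hf L M ?_
      rw [mem_Icc] at hM
      omega
  simp_rw [hin]
  rw [show ν + m + 1 = m + (ν + 1) by ring, sum_range_add, sum_eq_zero, zero_add]
  · exact sum_congr rfl fun n _ => if_pos (by omega)
  · intro L hL
    rw [mem_range] at hL
    exact if_neg (by omega)

lemma sum_polCoeff_mul_polCoeff {N i i' j j' : ℕ} (hi : i ≤ N) (hi' : i' ≤ N) (hj : j ≤ N)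
    (hj' : j' ≤ N) :
    ∑ L ∈ range (N + 1), ∑ M ∈ Icc (-(L : ℤ)) L, polCoeff N L M i j * polCoeff N L M i' j'
      = if i = i' ∧ j = j' then 1 else 0 := by
  -- Entries on different diagonals are never nonzero for the same `M`; on a common diagonal, dual
  -- orthogonality applies.
  by_cases hd : (j : ℤ) - i = j' - i'
  swap
  · rw [if_neg (by rintro ⟨rfl, rfl⟩; exact hd rfl)]
    refine sum_eq_zero fun L _ => sum_eq_zero fun M _ => ?_
    by_cases h : M = (j : ℤ) - i
    · rw [polCoeff_eq_zero (k := i') (l := j') (by omega), mul_zero]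
    · rw [polCoeff_eq_zero h, zero_mul]
  rcases le_total i j with hij | hij
  · obtain ⟨m, rfl⟩ := Nat.exists_eq_add_of_le hij
    obtain rfl : j' = i' + m := by omega
    obtain ⟨ν, rfl⟩ := Nat.exists_eq_add_of_le' (show m ≤ N by omega)
    rw [sum_range_sum_Icc_eq (m := m) (M₀ := m) (Int.natAbs_natCast m) fun L M hM => by
      rw [polCoeff_eq_zero (by omega), zero_mul]]
    have hs : ((-1 : ℝ) ^ m) * (-1) ^ m = 1 := by
      rw [← mul_pow]
      norm_num
    rw [sum_congr rfl fun n hn => by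
      have hn : n ≤ ν := Nat.lt_succ_iff.mp (mem_range.mp hn)
      rw [polCoeff_pos hn (show i ≤ ν by omega), polCoeff_pos hn (show i' ≤ ν by omega),
        mul_mul_mul_comm, hs, one_mul], sum_hahnFun_mul_hahnFun_dual m (by omega) (by omega)]
    simp
  · obtain ⟨m, rfl⟩ := Nat.exists_eq_add_of_le hij
    obtain rfl : i' = j' + m := by omega
    obtain ⟨ν, rfl⟩ := Nat.exists_eq_add_of_le' (show m ≤ N by omega)
    rw [sum_range_sum_Icc_eq (m := m) (M₀ := -m) (by simp) fun L M hM => by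
      rw [polCoeff_eq_zero (by push_cast; omega), zero_mul]]
    rw [sum_congr rfl fun n hn => by
      have hn : n ≤ ν := Nat.lt_succ_iff.mp (mem_range.mp hn)
      rw [polCoeff_neg hn (show j ≤ ν by omega), polCoeff_neg hn (show j' ≤ ν by omega)],
      sum_hahnFun_mul_hahnFun_dual m (by omega) (by omega)]
    simp

lemma polCoeff_zero_zero {N i j : ℕ} (hi : i ≤ N) :
    polCoeff N 0 0 i j = if i = j then √(1 / ((N : ℝ) + 1)) else 0 := by
  split_ifs with h
  · subst h
    have h1 := polCoeff_pos (m := 0) (Nat.zero_le N) hi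
    simp only [add_zero, Nat.cast_zero, pow_zero, one_mul] at h1
    rw [h1, hahnFun, eval_hahnPoly 0 0 hi]
    have hw : hahnWeight 0 N i = 1 := by
      rw [hahnWeight]
      simp only [add_zero]
      field_simp
    have hn : hahnNorm 0 N 0 = 1 / ((N : ℝ) + 1) := by
      rw [hahnNorm]
      simp [Nat.factorial_succ]
      field_simp
    simp [hw, hn, hahnCoeff]
  · exact polCoeff_eq_zero (by omega)

lemma bigT_eq (d : ℕ) [NeZero d] : bigT d = deltaTensor d - (1 / (d : ℂ)) • 1 := by
  obtain ⟨N, rfl⟩ := Nat.exists_eq_succ_of_ne_zero (NeZero.ne d)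
  -- Completeness needs the term `L = 0`, which is the tensor square of `1/√d` times the identity.
  have hT : bigT (N + 1) = (∑ L ∈ range (N + 1), ∑ M ∈ Icc (-(L : ℤ)) (L : ℤ),
      polOp (N + 1) L M ⊗ₖ polOp (N + 1) L M) - polOp (N + 1) 0 0 ⊗ₖ polOp (N + 1) 0 0 := by
    rw [range_eq_Ico, sum_eq_sum_Ico_succ_bot (Nat.succ_pos N)]
    simp only [Nat.cast_zero, neg_zero, Icc_self, sum_singleton, add_sub_cancel_left]
    rfl
  rw [Nat.succ_eq_add_one, hT]
  ext ⟨i, i'⟩ ⟨j, j'⟩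
  simp only [Matrix.sub_apply, Matrix.sum_apply, Matrix.kroneckerMap_apply, polOp_apply,
    Matrix.smul_apply, smul_eq_mul, deltaTensor, Matrix.of_apply, Matrix.one_apply, Prod.mk.injEq]
  have h := sum_polCoeff_mul_polCoeff (Nat.lt_succ_iff.mp i.2) (Nat.lt_succ_iff.mp i'.2)
    (Nat.lt_succ_iff.mp j.2) (Nat.lt_succ_iff.mp j'.2)
  have h' := congrArg Complex.ofReal h
  push_cast at h'
  rw [h', polCoeff_zero_zero (Nat.lt_succ_iff.mp i.2), polCoeff_zero_zero (Nat.lt_succ_iff.mp i'.2)]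
  have hs : ((√(1 / ((N : ℝ) + 1)) : ℝ) : ℂ) * ((√(1 / ((N : ℝ) + 1)) : ℝ) : ℂ)
      = 1 / ((N + 1 : ℕ) : ℂ) := by
    rw [← Complex.ofReal_mul, Real.mul_self_sqrt (by positivity)]
    push_cast
    rfl
  rw [← hs]
  simp only [← Fin.ext_iff]
  by_cases h1 : i = j <;> by_cases h2 : i' = j' <;>
    simp [h1, h2, apply_ite Complex.ofReal]

end Qudit

/-! ### Comparison of the three expansions -/

theorem mainTheorem4 (d : ℕ) [NeZero d] :
    -- expansions of the Bell state
    Qudit.bellState d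
        = (1 / (d : ℂ) ^ 2) •
            ((1 : Matrix (Fin d) (Fin d) ℂ) ⊗ₖ (1 : Matrix (Fin d) (Fin d) ℂ))
          + (1 / (2 * (d : ℂ))) • Qudit.bigLambda d ∧
    Qudit.bellState d
        = (1 / (d : ℂ) ^ 2) •
            ((1 : Matrix (Fin d) (Fin d) ℂ) ⊗ₖ (1 : Matrix (Fin d) (Fin d) ℂ))
          + (1 / (d : ℂ)) • Qudit.bigT d ∧
    Qudit.bellState d
        = (1 / (d : ℂ) ^ 2) •
            ((1 : Matrix (Fin d) (Fin d) ℂ) ⊗ₖ (1 : Matrix (Fin d) (Fin d) ℂ))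
          + (1 / (d : ℂ) ^ 2) • Qudit.bigU d ∧
    -- expansions of the isotropic state
    (∀ α : ℝ,
      Qudit.isotropic d α
          = (1 / (d : ℂ) ^ 2) •
              ((1 : Matrix (Fin d) (Fin d) ℂ) ⊗ₖ (1 : Matrix (Fin d) (Fin d) ℂ))
            + ((α : ℂ) / (2 * (d : ℂ))) • Qudit.bigLambda d ∧
      Qudit.isotropic d α
          = (1 / (d : ℂ) ^ 2) •
              ((1 : Matrix (Fin d) (Fin d) ℂ) ⊗ₖ (1 : Matrix (Fin d) (Fin d) ℂ))
            + ((α : ℂ) / (d : ℂ)) • Qudit.bigT d ∧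
      Qudit.isotropic d α
          = (1 / (d : ℂ) ^ 2) •
              ((1 : Matrix (Fin d) (Fin d) ℂ) ⊗ₖ (1 : Matrix (Fin d) (Fin d) ℂ))
            + ((α : ℂ) / (d : ℂ) ^ 2) • Qudit.bigU d) ∧
    -- proportionality of the three tensors
    Qudit.bigLambda d = (2 : ℂ) • Qudit.bigT d ∧
    Qudit.bigT d = (1 / (d : ℂ)) • Qudit.bigU d := by
  have hd : (d : ℂ) ≠ 0 := by exact_mod_cast NeZero.ne d
  simp only [Qudit.isotropic, Qudit.bellState_eq, Qudit.bigLambda_eq, Qudit.bigT_eq, Qudit.bigU_eq,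
    Matrix.one_kronecker_one]
  -- Every claim is now an identity between combinations of `deltaTensor d` and `1`.
  refine ⟨?_, ?_, ?_, fun α => ⟨?_, ?_, ?_⟩, ?_, ?_⟩ <;>
    match_scalars <;> field_simp <;> ring
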